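/- Let $\mathbb R^{1,3}$ be Minkowski space with inner product $\langle\cdot,\cdot\rangle$ of signature $(-,+,+,+)$, flat connection $\nabla^{\mathbb R^{1,3}}$, canonical future-directed timelike unit vector $T_0$, and $\mathbb R^3=T_0^{\perp}$. Let $(\Sigma,\sigma)$ be a closed (compact, Hausdorff, without boundary) smooth Riemannian surface, for instance a $2$-sphere, and let $i_0:\Sigma\to\mathbb R^{1,3}$ be a smooth isometric immersion, in particular any smooth isometric embedding. Put $\tau=-\langle i_0,T_0\rangle$, let $\hat i_0=i_0-\tau T_0:\Sigma\to\mathbb R^3$ be the projection, and let $\hat\nu$ be a smooth unit normal field of $\hat i_0$ in $\mathbb R^3$ (for an embedded projection, for instance the outward one). Let $\hat e_3$ be $\hat\nu$, regarded by parallel translation along $T_0$ as a vector field along $i_0$. Then: (1) The metric induced on $\Sigma$ by $\hat i_0$ is $\hat\sigma=\sigma+d\tau\otimes d\tau$. (2) $\hat e_3$ is a spacelike unit normal field of $i_0$, and there is exactly one future-directed timelike unit normal field $\hat e_4$ of $i_0$ with $\langle\hat e_3,\hat e_4\rangle=0$. (3) Let $\hat k_0=\sum_{I=1}^2\langle\nabla_{\hat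 e_I}\hat\nu,\hat e_I\rangle$ (with $\hat e_1,\hat e_2$ a $\hat\sigma$-orthonormal tangent frame) be the mean curvature of $\hat\Sigma=\hat i_0(\Sigma)$ in $\mathbb R^3$ with respect to $\hat\nu$, let $\mathbf H_0$ be the mean curvature vector of $i_0$, that is, the $\sigma$-trace of its second fundamental form, and let $\alpha_{\hat e_3}(v)=\langle\nabla^{\mathbb R^{1,3}}_{v}\hat e_3,\hat e_4\rangle$. Let $\nabla\tau$ and $|\nabla\tau|$ be taken with respect to $\sigma$, and let $\mu_\sigma,\mu_{\hat\sigma}$ be the area measures of $\sigma,\hat\sigma$. Then both integrands below are integrable and $$\int_{\Sigma}\hat k_0\,\mu_{\hat\sigma}=\int_\Sigma\Big(-\sqrt{1+|\nabla\tau|^2}\,\langle\mathbf H_0,\hat e_3\rangle-\alpha_{\hat e_3}(\nabla\tau)\Big)\,\mu_\sigma .$$ -/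

import Mathlib

open MeasureTheory
open scoped Manifold ContDiff

noncomputable section

namespace WangYau

/-- Euclidean `ℝ²`, the model space of surfaces. -/
abbrev E2 := EuclideanSpace ℝ (Fin 2)

/-- Euclidean `ℝ³`. -/
abbrev E3 := EuclideanSpace ℝ (Fin 3)

/-! ### Minkowski space -/

/-- Minkowski space `ℝ^{1,3}`: a point is a pair (time coordinate, position in `ℝ³`). -/
abbrev Minkowski := ℝ × E3

/-- The Minkowski inner product, of signature `(-,+,+,+)`. -/
def eta (u v : Minkowski) : ℝ := -(u.1 * v.1) + inner ℝ u.2 v.2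

/-- The canonical future-directed timelike unit vector. -/
def T0 : Minkowski := (1, 0)

section Surface

variable {S : Type*} [TopologicalSpace S] [ChartedSpace E2 S]

/-! ### Metric notions on a surface

A field of bilinear forms on the tangent spaces of `S` is written
`g : ∀ x : S, TangentSpace (𝓡 2) x →L[ℝ] TangentSpace (𝓡 2) x →L[ℝ] ℝ`. The definitions are used for
symmetric positive definite `g`. -/

/-- The differential at `x` of a map from the surface to a vector space. For a field `f` along the
surface with values in a flat space, `dAt f x v` is the flat covariant derivative of `f` along `v`. -/
def dAt {V : Type*} [NormedAddCommGroup V] [NormedSpace ℝ V] (f : S → V) (x : S) :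
    TangentSpace (𝓡 2) x →L[ℝ] V :=
  mfderiv (𝓡 2) 𝓘(ℝ, V) f x

/-- The coordinate basis of `T_x S` given by the preferred chart at `x`. -/
def tb (x : S) (i : Fin 2) : TangentSpace (𝓡 2) x := EuclideanSpace.single i (1 : ℝ)

/-- The matrix `g_{ij}` of `g` at `x` in the basis `tb x`. -/
def gram (g : ∀ x : S, TangentSpace (𝓡 2) x →L[ℝ] TangentSpace (𝓡 2) x →L[ℝ] ℝ) (x : S) :
    Matrix (Fin 2) (Fin 2) ℝ :=
  Matrix.of fun i j => g x (tb x i) (tb x j)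

/-- The trace `g^{ij} B_{ij}` with respect to `g` of a vector valued bilinear expression with
components `B i j` in the basis `tb x`. -/
def traceAt {V : Type*} [AddCommGroup V] [Module ℝ V]
    (g : ∀ x : S, TangentSpace (𝓡 2) x →L[ℝ] TangentSpace (𝓡 2) x →L[ℝ] ℝ) (x : S)
    (B : Fin 2 → Fin 2 → V) : V :=
  ∑ i, ∑ j, (gram g x)⁻¹ i j • B i j

/-- The gradient `∇f = g^{ij} (∂_j f) ∂_i`. -/
def grad (g : ∀ x : S, TangentSpace (𝓡 2) x →L[ℝ] TangentSpace (𝓡 2) x →L[ℝ] ℝ)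
    (f : S → ℝ) (x : S) : TangentSpace (𝓡 2) x :=
  traceAt g x fun i j => dAt f x (tb x j) • tb x i

/-- The area density `√det(g_{ij})` of `g` in the preferred chart at `p`, at the coordinate
point `y`; here `∂_i` is the image of the `i`-th basis vector under the inverse chart. -/
def areaDensity (g : ∀ x : S, TangentSpace (𝓡 2) x →L[ℝ] TangentSpace (𝓡 2) x →L[ℝ] ℝ)
    (p : S) (y : E2) : ℝ :=
  Real.sqrt (Matrix.det (Matrix.of fun i j : Fin 2 =>
    g ((chartAt E2 p).symm y)
      (mfderiv 𝓘(ℝ, E2) (𝓡 2) (chartAt E2 p).symm y (EuclideanSpace.single i (1 : ℝ)))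
      (mfderiv 𝓘(ℝ, E2) (𝓡 2) (chartAt E2 p).symm y (EuclideanSpace.single j (1 : ℝ)))))

/-- The area measure of `g` on the domain of the preferred chart at `p`, extended by zero:
`A ↦ ∫_{φ(A ∩ dom φ)} √det(g_{ij}) dy`. -/
def chartAreaMeasure [MeasurableSpace S]
    (g : ∀ x : S, TangentSpace (𝓡 2) x →L[ℝ] TangentSpace (𝓡 2) x →L[ℝ] ℝ) (p : S) : Measure S :=
  Measure.map (chartAt E2 p).symm
    ((volume.restrict (chartAt E2 p).target).withDensity
      fun y => ENNReal.ofReal (areaDensity g p y))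

/-- The Riemannian area measure `μ_g`. By the change of variables formula the measures
`chartAreaMeasure g p` agree on overlaps of chart domains, so that their least upper bound, in the
lattice of measures, is the measure that restricts to each of them. -/
def areaMeasure [MeasurableSpace S]
    (g : ∀ x : S, TangentSpace (𝓡 2) x →L[ℝ] TangentSpace (𝓡 2) x →L[ℝ] ℝ) : Measure S :=
  ⨆ p : S, chartAreaMeasure g p

/-! ### Surfaces in `ℝ³` -/

/-- `ν` is a smooth unit normal field along `F : S → ℝ³`. -/
structure IsUnitNormal (F : S → E3) (ν : S → E3) : Prop where
  smooth : ContMDiff (𝓡 2) 𝓘(ℝ, E3) ∞ ν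
  unit : ∀ x, ‖ν x‖ = 1
  normal : ∀ x v, inner ℝ (ν x) (dAt F x v) = 0

/-- The mean curvature `∑_I ⟨∇_{e_I} ν, e_I⟩` of `F : S → ℝ³` with respect to the unit normal `ν`
(`e_1, e_2` orthonormal and tangent), where `g` is the metric induced by `F`. -/
def meanCurvature (g : ∀ x : S, TangentSpace (𝓡 2) x →L[ℝ] TangentSpace (𝓡 2) x →L[ℝ] ℝ)
    (F ν : S → E3) (x : S) : ℝ :=
  traceAt g x fun i j => inner ℝ (dAt ν x (tb x i)) (dAt F x (tb x j))

/-! ### Spacelike surfaces in Minkowski space -/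

/-- The component of `w` normal to the surface `X` at `x`, where `g` is the metric induced by `X`. -/
def normalPart (g : ∀ x : S, TangentSpace (𝓡 2) x →L[ℝ] TangentSpace (𝓡 2) x →L[ℝ] ℝ)
    (X : S → Minkowski) (x : S) (w : Minkowski) : Minkowski :=
  w - traceAt g x fun i j => eta w (dAt X x (tb x i)) • dAt X x (tb x j)

/-- The second fundamental form `II(∂_i, ∂_j) = (∂_i ∂_j X)^⊥`, in the preferred chart at `x`. -/
def secondFF (g : ∀ x : S, TangentSpace (𝓡 2) x →L[ℝ] TangentSpace (𝓡 2) x →L[ℝ] ℝ)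
    (X : S → Minkowski) (x : S) (i j : Fin 2) : Minkowski :=
  normalPart g X x
    (fderiv ℝ (fderiv ℝ (X ∘ (chartAt E2 x).symm)) (chartAt E2 x x)
      (EuclideanSpace.single i (1 : ℝ)) (EuclideanSpace.single j (1 : ℝ)))

/-- The mean curvature vector `H = g^{ij} II(∂_i, ∂_j)`. -/
def meanCurvatureVector
    (g : ∀ x : S, TangentSpace (𝓡 2) x →L[ℝ] TangentSpace (𝓡 2) x →L[ℝ] ℝ)
    (X : S → Minkowski) (x : S) : Minkowski :=
  traceAt g x (secondFF g X x)

/-- `(e₃, e₄)` is an orthonormal frame of the normal bundle of `X` with `e₃` spacelike and `e₄`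
timelike and future-directed. -/
structure IsNormalFrame (X e₃ e₄ : S → Minkowski) : Prop where
  normal₃ : ∀ x v, eta (e₃ x) (dAt X x v) = 0
  normal₄ : ∀ x v, eta (e₄ x) (dAt X x v) = 0
  unit₃ : ∀ x, eta (e₃ x) (e₃ x) = 1
  unit₄ : ∀ x, eta (e₄ x) (e₄ x) = -1
  ortho : ∀ x, eta (e₃ x) (e₄ x) = 0
  future : ∀ x, eta (e₄ x) T0 < 0

/-- The connection one-form `α_{e₃}(v) = ⟨∇_v e₃, e₄⟩` of the normal bundle. -/
def connectionForm (e₃ e₄ : S → Minkowski) (x : S) (v : TangentSpace (𝓡 2) x) : ℝ :=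
  eta (dAt e₃ x v) (e₄ x)

/-- The generalized mean curvature `-√(1 + |∇τ|²) ⟨H, e₃⟩ - α_{e₃}(∇τ)`. -/
def generalizedMeanCurvature
    (g : ∀ x : S, TangentSpace (𝓡 2) x →L[ℝ] TangentSpace (𝓡 2) x →L[ℝ] ℝ)
    (X : S → Minkowski) (τ : S → ℝ) (e₃ e₄ : S → Minkowski) (x : S) : ℝ :=
  -Real.sqrt (1 + g x (grad g τ x) (grad g τ x)) * eta (meanCurvatureVector g X x) (e₃ x)
    - connectionForm e₃ e₄ x (grad g τ x)

/-! ### Time function and projection -/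

/-- The time function `τ = -⟨X, T₀⟩`. -/
def timeFunction (X : S → Minkowski) (x : S) : ℝ := -eta (X x) T0

/-- The projection of `X` to the orthogonal complement `ℝ³` of `T₀`. -/
def projection (X : S → Minkowski) (x : S) : E3 := (X x).2

/-- The form `g + dτ ⊗ dτ`. -/
def graphMetric (g : ∀ x : S, TangentSpace (𝓡 2) x →L[ℝ] TangentSpace (𝓡 2) x →L[ℝ] ℝ)
    (τ : S → ℝ) (x : S) : TangentSpace (𝓡 2) x →L[ℝ] TangentSpace (𝓡 2) x →L[ℝ] ℝ :=
  g x + (dAt τ x).smulRight (dAt τ x)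

/-- A field `ν` along the projected surface, carried to the surface in Minkowski space by parallel
translation along `T₀`. -/
def liftNormal (ν : S → E3) (x : S) : Minkowski := (0, ν x)

end Surface

end WangYau

end

open WangYau

/-!
The identity between the two integrals holds pointwise, before integration: no integration by parts
is involved. Write `X = (τ, F)`, so that `F` is the projection, `h(v, w) = ⟨dν v, dF w⟩` and
`f = √(1 + |∇τ|²)`.

* The future-directed unit normal orthogonal to `(0, ν)` is `e₄ = (T₀ + dX(∇τ)) / f`
  (`isNormalFrame_timelikeNormal`). It is the only one, since a vector of `ℝ³` orthogonal to `dF`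
  and to `ν` vanishes (`IsNormalFrame.eq_timelikeNormal`).
* Differentiating `⟨ν, ∂ⱼF⟩ = 0` gives `⟨II(∂ᵢ, ∂ⱼ), e₃⟩ = -h(∂ᵢ, ∂ⱼ)` (`eta_secondFF`), hence
  `⟨H, e₃⟩ = -tr_σ h`, and the formula for `e₄` gives `α(∇τ) = h(∇τ, ∇τ) / f`. The inverse of
  `σ + dτ ⊗ dτ` being `σ⁻¹ - ∇τ ⊗ ∇τ / f²` (`IsMetric.traceAt_graphMetric`), the mean curvature of
  the projection is `tr_σ h - h(∇τ, ∇τ) / f²`. So `f` times it is the generalized mean curvature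
  (`areaFactor_mul_meanCurvature`).
* As `det(σ + dτ ⊗ dτ) = f² det σ`, the area measure of `σ + dτ ⊗ dτ` has density `f` with respect
  to that of `σ` (`areaMeasure_graphMetric`). This passes from the charts to the supremum over all
  charts because multiplication by a positive finite density is an order automorphism of the
  measures (`iSup_withDensity`).

Integrability follows from the continuity of the integrands, read off in the coordinate frames of
a fixed chart, and from the finiteness of the area (`isFiniteMeasure_areaMeasure`). For the latter
the change of variables formula shows that the area measures of two charts agree on overlaps, so
that the supremum over all charts is bounded by a finite sum over compact pieces of charts.
-/

noncomputable section

namespace WangYau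

/-! ### Contractions of two by two matrices -/

theorem sum_inv_smul_fin_two {V : Type*} [AddCommGroup V] [Module ℝ V]
    (M : Matrix (Fin 2) (Fin 2) ℝ) (B : Fin 2 → Fin 2 → V) :
    ∑ i, ∑ j, M⁻¹ i j • B i j =
      M.det⁻¹ • (M 1 1 • B 0 0 - M 0 1 • B 0 1 - M 1 0 • B 1 0 + M 0 0 • B 1 1) := by
  simp only [Matrix.inv_def, Ring.inverse_eq_inv', Matrix.adjugate_fin_two, Fin.sum_univ_two,
    Matrix.smul_apply, Matrix.of_apply, Matrix.cons_val', Matrix.cons_val_zero,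
    Matrix.cons_val_one, Matrix.cons_val_fin_one, smul_eq_mul]
  module

/-! ### The Minkowski inner product -/

theorem eta_comm (u v : Minkowski) : eta u v = eta v u := by
  simp only [eta, real_inner_comm, mul_comm]

theorem eta_add_left (u v w : Minkowski) : eta (u + v) w = eta u w + eta v w := by
  simp only [eta, Prod.fst_add, Prod.snd_add, inner_add_left]; ring

theorem eta_sub_left (u v w : Minkowski) : eta (u - v) w = eta u w - eta v w := by
  simp only [eta, Prod.fst_sub, Prod.snd_sub, inner_sub_left]; ring

theorem eta_smul_left (c : ℝ) (u w : Minkowski) : eta (c • u) w = c * eta u w := by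
  simp only [eta, Prod.smul_fst, Prod.smul_snd, real_inner_smul_left, smul_eq_mul]; ring

theorem eta_add_right (u v w : Minkowski) : eta u (v + w) = eta u v + eta u w := by
  simp only [eta_comm u, eta_add_left]

theorem eta_smul_right (c : ℝ) (u w : Minkowski) : eta u (c • w) = c * eta u w := by
  simp only [eta_comm u, eta_smul_left]

variable {S : Type*} [TopologicalSpace S] [ChartedSpace E2 S]

/-! ### Traces and determinants in arbitrary tangent frames -/

theorem tb_expansion {x : S} (v : TangentSpace (𝓡 2) x) :
    ∃ a b : ℝ, v = a • tb x 0 + b • tb x 1 := by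
  have key : ∀ w : E2, w = w 0 • (EuclideanSpace.single 0 (1 : ℝ) : E2)
      + w 1 • (EuclideanSpace.single 1 (1 : ℝ) : E2) := fun w => by
    ext i; fin_cases i <;> simp
  exact ⟨_, _, key v⟩

theorem linearIndependent_tb (x : S) : LinearIndependent ℝ (tb x) := by
  have h := (EuclideanSpace.basisFun (Fin 2) ℝ).toBasis.linearIndependent
  have h2 : ⇑(EuclideanSpace.basisFun (Fin 2) ℝ).toBasis =
      fun i => EuclideanSpace.single i (1 : ℝ) := by ext1 i; simp
  rw [h2] at h
  exact h

/-- The matrix of the bilinear form `g x` in the family `e` of tangent vectors at `x`. -/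
def frameGram (g : ∀ x : S, TangentSpace (𝓡 2) x →L[ℝ] TangentSpace (𝓡 2) x →L[ℝ] ℝ) (x : S)
    (e : Fin 2 → TangentSpace (𝓡 2) x) : Matrix (Fin 2) (Fin 2) ℝ :=
  Matrix.of fun i j => g x (e i) (e j)

/-- `g` is a field of inner products on the tangent spaces. -/
structure IsMetric (g : ∀ x : S, TangentSpace (𝓡 2) x →L[ℝ] TangentSpace (𝓡 2) x →L[ℝ] ℝ) :
    Prop where
  symm : ∀ x v w, g x v w = g x w v
  pos : ∀ x v, v ≠ 0 → 0 < g x v v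

variable {g : ∀ x : S, TangentSpace (𝓡 2) x →L[ℝ] TangentSpace (𝓡 2) x →L[ℝ] ℝ}

theorem IsMetric.det_frameGram_pos (hg : IsMetric g) {x : S} {e : Fin 2 → TangentSpace (𝓡 2) x}
    (he : LinearIndependent ℝ e) : 0 < (frameGram g x e).det := by
  have h0 : 0 < g x (e 0) (e 0) := hg.pos x _ (he.ne_zero 0)
  -- the vector orthogonal to `e 0` has square length `g(e₀, e₀)` times the determinant
  have hv : g x (e 0) (e 1) • e 0 - g x (e 0) (e 0) • e 1 ≠ 0 := by
    intro h
    have := Fintype.linearIndependent_iff.1 he ![g x (e 0) (e 1), -g x (e 0) (e 0)]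
      (by simpa [Fin.sum_univ_two, sub_eq_add_neg] using h) 1
    simp at this
    exact h0.ne' this
  have h1 := hg.pos x _ hv
  have hs := hg.symm x (e 1) (e 0)
  simp only [frameGram, Matrix.det_fin_two, Matrix.of_apply]
  simp only [map_sub, map_smul, sub_apply, smul_apply,
    smul_eq_mul, hs] at h1 ⊢
  nlinarith

/-- Passing from the basis `tb x` to a family `e` multiplies both the Gram determinant and
the contraction with the adjugate Gram matrix by the square of the determinant `d` of the change
of basis. The family need not be independent. -/
theorem det_frameGram_change {x : S} (e : Fin 2 → TangentSpace (𝓡 2) x) : ∃ d : ℝ,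
    (∀ k : ∀ x : S, TangentSpace (𝓡 2) x →L[ℝ] TangentSpace (𝓡 2) x →L[ℝ] ℝ,
      (frameGram k x e).det = d ^ 2 * (gram k x).det) ∧
    ∀ (k : ∀ x : S, TangentSpace (𝓡 2) x →L[ℝ] TangentSpace (𝓡 2) x →L[ℝ] ℝ)
      (b : TangentSpace (𝓡 2) x →ₗ[ℝ] TangentSpace (𝓡 2) x →ₗ[ℝ] ℝ),
      k x (e 1) (e 1) * b (e 0) (e 0) - k x (e 0) (e 1) * b (e 0) (e 1)
        - k x (e 1) (e 0) * b (e 1) (e 0) + k x (e 0) (e 0) * b (e 1) (e 1) =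
      d ^ 2 * (k x (tb x 1) (tb x 1) * b (tb x 0) (tb x 0)
        - k x (tb x 0) (tb x 1) * b (tb x 0) (tb x 1)
        - k x (tb x 1) (tb x 0) * b (tb x 1) (tb x 0)
        + k x (tb x 0) (tb x 0) * b (tb x 1) (tb x 1)) := by
  obtain ⟨p, q, h0⟩ := tb_expansion (e 0)
  obtain ⟨r, s, h1⟩ := tb_expansion (e 1)
  refine ⟨p * s - q * r, fun k => ?_, fun k b => ?_⟩
  · simp only [frameGram, gram, Matrix.det_fin_two, Matrix.of_apply, h0, h1, map_add, map_smul,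
      add_apply, smul_apply, smul_eq_mul]
    ring
  · simp only [h0, h1, map_add, map_smul,
      add_apply, smul_apply, LinearMap.add_apply, LinearMap.smul_apply, smul_eq_mul]
    ring

/-- The trace of a bilinear form may be computed in any frame. -/
theorem IsMetric.traceAt_eq_frame (hg : IsMetric g) {x : S} {e : Fin 2 → TangentSpace (𝓡 2) x}
    (he : LinearIndependent ℝ e)
    (b : TangentSpace (𝓡 2) x →ₗ[ℝ] TangentSpace (𝓡 2) x →ₗ[ℝ] ℝ) :
    traceAt g x (fun i j => b (tb x i) (tb x j)) = (frameGram g x e).det⁻¹ *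
      (g x (e 1) (e 1) * b (e 0) (e 0) - g x (e 0) (e 1) * b (e 0) (e 1)
        - g x (e 1) (e 0) * b (e 1) (e 0) + g x (e 0) (e 0) * b (e 1) (e 1)) := by
  obtain ⟨d, h1, h2⟩ := det_frameGram_change e
  have hd := hg.det_frameGram_pos he
  rw [h1 g] at hd
  have hd2 : d ≠ 0 := by rintro h; simp [h] at hd
  have hG : (gram g x).det ≠ 0 := by rintro h; simp [h] at hd
  rw [traceAt, sum_inv_smul_fin_two, h1 g, h2 g b]
  simp only [gram, Matrix.of_apply, smul_eq_mul]
  simp only [gram] at hG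
  field_simp

/-! ### The flat differential -/

section Differential

variable {V W : Type*} [NormedAddCommGroup V] [NormedSpace ℝ V] [NormedAddCommGroup W]
  [NormedSpace ℝ W]

theorem dAt_continuousLinearMap_comp (L : V →L[ℝ] W) {f : S → V} {x : S}
    (hf : MDifferentiableAt (𝓡 2) 𝓘(ℝ, V) f x) (v : TangentSpace (𝓡 2) x) :
    dAt (fun y => L (f y)) x v = L (dAt f x v) := by
  have h := mfderiv_comp x (I' := 𝓘(ℝ, V)) (I'' := 𝓘(ℝ, W)) (g := L)
    L.differentiableAt.mdifferentiableAt hf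
  have h2 : mfderiv 𝓘(ℝ, V) 𝓘(ℝ, W) L (f x) = L := by
    rw [mfderiv_eq_fderiv]; exact L.fderiv
  rw [h2] at h
  exact congrArg (fun A => A v) h

/-- In the preferred chart at `x` the identification of `T_x S` with `ℝ²` is the identity. -/
theorem dAt_eq_fderiv_chart {f : S → V} {x : S} (hf : MDifferentiableAt (𝓡 2) 𝓘(ℝ, V) f x)
    (v : TangentSpace (𝓡 2) x) :
    dAt f x v = fderiv ℝ (f ∘ (chartAt E2 x).symm) (chartAt E2 x x) (v : E2) := by
  have key : ∀ A : E2 →L[ℝ] V, HasFDerivWithinAt (f ∘ (chartAt E2 x).symm) A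
      (Set.range (id : E2 → E2)) (chartAt E2 x x) →
      A = fderiv ℝ (f ∘ (chartAt E2 x).symm) (chartAt E2 x x) := fun A h => by
    rw [Set.range_id, hasFDerivWithinAt_univ] at h
    exact h.fderiv.symm
  exact congrArg (fun A : E2 →L[ℝ] V => A v) (key _ hf.hasMFDerivAt.2)

/-- The coordinate frame on the domain of the chart at `p`, as a function of the coordinate
point. -/
def chartFrame (p : S) (y : E2) (i : Fin 2) : TangentSpace (𝓡 2) ((chartAt E2 p).symm y) :=
  mfderiv 𝓘(ℝ, E2) (𝓡 2) (chartAt E2 p).symm y (EuclideanSpace.single i (1 : ℝ))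

variable [IsManifold (𝓡 2) ∞ S]

/-- In the coordinate frame of a chart, the differential of `f` is the ordinary derivative of
`f` read in that chart. -/
theorem dAt_chartFrame {f : S → V} (hf : ContMDiff (𝓡 2) 𝓘(ℝ, V) ∞ f) (p : S) {y : E2}
    (hy : y ∈ (chartAt E2 p).target) (i : Fin 2) :
    dAt f ((chartAt E2 p).symm y) (chartFrame p y i) =
      fderiv ℝ (f ∘ (chartAt E2 p).symm) y (EuclideanSpace.single i (1 : ℝ)) := by
  have h1 : MDifferentiableAt 𝓘(ℝ, E2) (𝓡 2) (chartAt E2 p).symm y :=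
    (mdifferentiable_chart (I := 𝓡 2) p).mdifferentiableAt_symm hy
  have h := mfderiv_comp y (hf.mdifferentiable (by simp) _) h1
  rw [mfderiv_eq_fderiv] at h
  exact (congrArg (fun A => A (EuclideanSpace.single i (1 : ℝ))) h).symm

theorem linearIndependent_chartFrame (p : S) {y : E2} (hy : y ∈ (chartAt E2 p).target) :
    LinearIndependent ℝ (chartFrame p y) := by
  have h := (EuclideanSpace.basisFun (Fin 2) ℝ).toBasis.linearIndependent
  have h2 : ⇑(EuclideanSpace.basisFun (Fin 2) ℝ).toBasis =
      fun i => EuclideanSpace.single i (1 : ℝ) := by ext1 i; simp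
  rw [h2] at h
  have hi := (mdifferentiable_chart (I := 𝓡 2) p).symm.mfderiv_injective hy
  exact h.map' (mfderiv 𝓘(ℝ, E2) (𝓡 2) (chartAt E2 p).symm y).toLinearMap
    (LinearMap.ker_eq_bot.2 hi)

theorem contDiffOn_chart_symm_comp {f : S → V} (hf : ContMDiff (𝓡 2) 𝓘(ℝ, V) ∞ f) (p : S) :
    ContDiffOn ℝ ∞ (f ∘ (chartAt E2 p).symm) (chartAt E2 p).target :=
  contMDiffOn_iff_contDiffOn.1 (hf.comp_contMDiffOn (contMDiffOn_chart_symm (I := 𝓡 2)))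

theorem continuousOn_fderiv_chart {f : S → V} (hf : ContMDiff (𝓡 2) 𝓘(ℝ, V) ∞ f) (p : S)
    (v : E2) :
    ContinuousOn (fun y => fderiv ℝ (f ∘ (chartAt E2 p).symm) y v) (chartAt E2 p).target :=
  ((contDiffOn_chart_symm_comp hf p).continuousOn_fderiv_of_isOpen
    (chartAt E2 p).open_target (by simp)).clm_apply continuousOn_const

end Differential

section Pointwise

variable {X : S → Minkowski} {ν : S → E3}

/-! ### The gradient and the metric `g + df ⊗ df` -/

theorem IsMetric.apply_grad (hg : IsMetric g) (f : S → ℝ) (x : S) (v : TangentSpace (𝓡 2) x) :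
    g x (grad g f x) v = dAt f x v := by
  have hd := (hg.det_frameGram_pos (linearIndependent_tb x)).ne'
  have hs := hg.symm x (tb x 1) (tb x 0)
  obtain ⟨a, b, rfl⟩ := tb_expansion v
  rw [grad, traceAt, sum_inv_smul_fin_two]
  simp only [frameGram, gram, Matrix.det_fin_two, Matrix.of_apply, map_add, map_sub, map_smul,
    add_apply, sub_apply, smul_apply, smul_eq_mul, hs] at hd ⊢
  rw [← pow_two] at hd
  field_simp
  ring

theorem IsMetric.apply_grad_self (hg : IsMetric g) (f : S → ℝ) (x : S) :
    dAt f x (grad g f x) = g x (grad g f x) (grad g f x) := (hg.apply_grad f x _).symm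

theorem IsMetric.apply_self_nonneg (hg : IsMetric g) (x : S) (v : TangentSpace (𝓡 2) x) :
    0 ≤ g x v v := by
  rcases eq_or_ne v 0 with rfl | h
  · simp
  · exact (hg.pos x v h).le

theorem graphMetric_apply (f : S → ℝ) (x : S) (v w : TangentSpace (𝓡 2) x) :
    graphMetric g f x v w = g x v w + dAt f x v * dAt f x w := by
  simp [graphMetric]

theorem IsMetric.graphMetric (hg : IsMetric g) (f : S → ℝ) : IsMetric (graphMetric g f) where
  symm x v w := by rw [graphMetric_apply, graphMetric_apply, hg.symm, mul_comm]
  pos x v hv := by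
    rw [graphMetric_apply]
    exact add_pos_of_pos_of_nonneg (hg.pos x v hv) (mul_self_nonneg _)

/-- The factor `√(1 + |∇f|²)` by which the area element of `g + df ⊗ df` exceeds that of `g`. -/
def areaFactor (g : ∀ x : S, TangentSpace (𝓡 2) x →L[ℝ] TangentSpace (𝓡 2) x →L[ℝ] ℝ)
    (f : S → ℝ) (x : S) : ℝ :=
  Real.sqrt (1 + g x (grad g f x) (grad g f x))

theorem IsMetric.areaFactor_pos (hg : IsMetric g) (f : S → ℝ) (x : S) : 0 < areaFactor g f x :=
  Real.sqrt_pos.2 (by have := hg.apply_self_nonneg x (grad g f x); linarith)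

theorem IsMetric.areaFactor_sq (hg : IsMetric g) (f : S → ℝ) (x : S) :
    areaFactor g f x ^ 2 = 1 + g x (grad g f x) (grad g f x) :=
  Real.sq_sqrt (by have := hg.apply_self_nonneg x (grad g f x); linarith)

/-- The matrix determinant lemma `det(g + df ⊗ df) = (1 + |∇f|²) det g`. -/
theorem IsMetric.det_frameGram_graphMetric (hg : IsMetric g) (f : S → ℝ) {x : S}
    (e : Fin 2 → TangentSpace (𝓡 2) x) :
    (frameGram (WangYau.graphMetric g f) x e).det =
      areaFactor g f x ^ 2 * (frameGram g x e).det := by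
  obtain ⟨d, h, -⟩ := det_frameGram_change e
  rw [h, h, hg.areaFactor_sq, ← hg.apply_grad_self]
  have hd := (hg.det_frameGram_pos (linearIndependent_tb x)).ne'
  have hs := hg.symm x (tb x 1) (tb x 0)
  rw [grad, traceAt, sum_inv_smul_fin_two]
  simp only [frameGram, gram, Matrix.det_fin_two, Matrix.of_apply, map_add, map_sub, map_smul,
    graphMetric_apply, smul_eq_mul, hs] at hd ⊢
  rw [← pow_two] at hd
  field_simp
  ring

/-- The trace with respect to `g + df ⊗ df`, in terms of the trace with respect to `g`: the inverse
of `g + df ⊗ df` is `g⁻¹ - ∇f ⊗ ∇f / (1 + |∇f|²)`. -/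
theorem IsMetric.traceAt_graphMetric (hg : IsMetric g) (f : S → ℝ) (x : S)
    (b : TangentSpace (𝓡 2) x →ₗ[ℝ] TangentSpace (𝓡 2) x →ₗ[ℝ] ℝ) :
    traceAt (WangYau.graphMetric g f) x (fun i j => b (tb x i) (tb x j)) =
      traceAt g x (fun i j => b (tb x i) (tb x j))
        - b (grad g f x) (grad g f x) / areaFactor g f x ^ 2 := by
  have hf := hg.areaFactor_pos f x
  have hdet : (gram (WangYau.graphMetric g f) x).det = areaFactor g f x ^ 2 * (gram g x).det :=
    hg.det_frameGram_graphMetric f (tb x)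
  have hd : (gram g x).det ≠ 0 := (hg.det_frameGram_pos (linearIndependent_tb x)).ne'
  have hs := hg.symm x (tb x 1) (tb x 0)
  have hF : areaFactor g f x ^ 2 * (gram g x).det = (gram g x).det
      + (g x (tb x 1) (tb x 1) * dAt f x (tb x 0) ^ 2
        - 2 * g x (tb x 0) (tb x 1) * dAt f x (tb x 0) * dAt f x (tb x 1)
        + g x (tb x 0) (tb x 0) * dAt f x (tb x 1) ^ 2) := by
    rw [← hdet]
    simp only [gram, Matrix.det_fin_two, Matrix.of_apply, graphMetric_apply, hs]
    ring
  have hD : (gram g x).det = g x (tb x 0) (tb x 0) * g x (tb x 1) (tb x 1)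
      - g x (tb x 0) (tb x 1) * g x (tb x 0) (tb x 1) := by
    simp only [gram, Matrix.det_fin_two, Matrix.of_apply, hs]
  rw [traceAt, traceAt, grad, traceAt, sum_inv_smul_fin_two, sum_inv_smul_fin_two,
    sum_inv_smul_fin_two, hdet]
  simp only [map_add, map_sub, map_smul, LinearMap.add_apply, LinearMap.sub_apply,
    LinearMap.smul_apply, smul_eq_mul]
  simp only [gram, Matrix.of_apply, graphMetric_apply, hs] at hF hD hd ⊢
  set D := (Matrix.of fun i j => g x (tb x i) (tb x j)).det
  field_simp
  linear_combination (-(g x (tb x 1) (tb x 1) * b (tb x 0) (tb x 0)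
      - g x (tb x 0) (tb x 1) * (b (tb x 0) (tb x 1) + b (tb x 1) (tb x 0))
      + g x (tb x 0) (tb x 0) * b (tb x 1) (tb x 1))) * hF
    + (dAt f x (tb x 1) ^ 2 * b (tb x 0) (tb x 0)
      - dAt f x (tb x 0) * dAt f x (tb x 1) * (b (tb x 0) (tb x 1) + b (tb x 1) (tb x 0))
      + dAt f x (tb x 0) ^ 2 * b (tb x 1) (tb x 1)) * hD

/-! ### The projection of a spacelike surface -/

theorem dAt_eq_prodMk (hX : MDifferentiable (𝓡 2) 𝓘(ℝ, Minkowski) X) (x : S)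
    (v : TangentSpace (𝓡 2) x) :
    dAt X x v = (dAt (timeFunction X) x v, dAt (projection X) x v) := by
  have h1 := dAt_continuousLinearMap_comp (ContinuousLinearMap.fst ℝ ℝ E3) (hX x) v
  have h2 := dAt_continuousLinearMap_comp (ContinuousLinearMap.snd ℝ ℝ E3) (hX x) v
  have h3 : timeFunction X = fun y => ContinuousLinearMap.fst ℝ ℝ E3 (X y) := by
    ext y; simp [timeFunction, eta, T0]
  rw [h3, h1]
  exact Prod.ext rfl h2.symm

theorem inner_dAt_projection (hX : MDifferentiable (𝓡 2) 𝓘(ℝ, Minkowski) X)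
    (hiso : ∀ (x : S) (v w : TangentSpace (𝓡 2) x), eta (dAt X x v) (dAt X x w) = g x v w)
    (x : S) (v w : TangentSpace (𝓡 2) x) :
    inner ℝ (dAt (projection X) x v) (dAt (projection X) x w) =
      graphMetric g (timeFunction X) x v w := by
  rw [graphMetric_apply, ← hiso, dAt_eq_prodMk hX, dAt_eq_prodMk hX]
  simp [eta]

theorem dAt_liftNormal (hν : MDifferentiable (𝓡 2) 𝓘(ℝ, E3) ν) (x : S)
    (v : TangentSpace (𝓡 2) x) : dAt (liftNormal ν) x v = (0, dAt ν x v) :=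
  dAt_continuousLinearMap_comp (ContinuousLinearMap.inr ℝ ℝ E3) (hν x) v

/-- The vector `T₀ + dX(∇τ)` normal to the surface, divided by its length `√(1 + |∇τ|²)`. -/
def timelikeNormal (g : ∀ x : S, TangentSpace (𝓡 2) x →L[ℝ] TangentSpace (𝓡 2) x →L[ℝ] ℝ)
    (X : S → Minkowski) (x : S) : Minkowski :=
  (areaFactor g (timeFunction X) x)⁻¹ • (T0 + dAt X x (grad g (timeFunction X) x))

theorem eta_T0_left (u : Minkowski) : eta T0 u = -u.1 := by simp [eta, T0]

theorem isNormalFrame_timelikeNormal (hg : IsMetric g)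
    (hX : MDifferentiable (𝓡 2) 𝓘(ℝ, Minkowski) X)
    (hiso : ∀ (x : S) (v w : TangentSpace (𝓡 2) x), eta (dAt X x v) (dAt X x w) = g x v w)
    (hν : IsUnitNormal (projection X) ν) :
    IsNormalFrame X (liftNormal ν) (timelikeNormal g X) := by
  have hn : ∀ x v, eta (liftNormal ν x) (dAt X x v) = 0 := fun x v => by
    rw [dAt_eq_prodMk hX]
    simpa [eta, liftNormal] using hν.normal x v
  have hp := hg.areaFactor_pos (timeFunction X)
  have hsq := hg.areaFactor_sq (timeFunction X)
  refine ⟨hn, fun x v => ?_, fun x => ?_, fun x => ?_, fun x => ?_, fun x => ?_⟩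
  · rw [timelikeNormal, eta_smul_left, eta_add_left, hiso, hg.apply_grad, eta_T0_left,
      dAt_eq_prodMk hX]
    simp
  · simp [eta, liftNormal, hν.unit x]
  · have h1 := hsq x
    have h2 := hp x
    rw [timelikeNormal, eta_smul_left, eta_smul_right, eta_add_left, eta_add_right,
      eta_add_right, hiso, eta_comm (dAt X x _) T0, eta_T0_left, eta_T0_left, dAt_eq_prodMk hX,
      hg.apply_grad_self]
    simp only [T0]
    field_simp
    linarith
  · rw [timelikeNormal, eta_smul_right, eta_add_right, hn]
    simp [eta, liftNormal, T0]
  · rw [eta_comm, eta_T0_left, timelikeNormal, dAt_eq_prodMk hX]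
    simp only [T0, Prod.smul_fst, Prod.fst_add, smul_eq_mul, hg.apply_grad_self, ← hsq]
    have := hp x
    have := hg.apply_self_nonneg x (grad g (timeFunction X) x)
    rw [neg_lt_zero]
    positivity

/-- A vector of `ℝ³` orthogonal to a surface and to its unit normal vanishes. -/
theorem eq_zero_of_orthogonal {F : S → E3} {k : ∀ x : S, TangentSpace (𝓡 2) x →L[ℝ]
    TangentSpace (𝓡 2) x →L[ℝ] ℝ} (hk : IsMetric k)
    (hF : ∀ x v w, inner ℝ (dAt F x v) (dAt F x w) = k x v w) (hν : IsUnitNormal F ν) {x : S}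
    {w : E3} (hw : ∀ v, inner ℝ (dAt F x v) w = 0) (hw' : inner ℝ (ν x) w = 0) : w = 0 := by
  have hli : LinearIndependent ℝ ![dAt F x (tb x 0), dAt F x (tb x 1), ν x] := by
    rw [Fintype.linearIndependent_iff]
    intro c hc
    simp only [Fin.sum_univ_three, Matrix.cons_val_zero, Matrix.cons_val_one,
      Matrix.cons_val] at hc
    have h2 : c 2 = 0 := by
      have := congrArg (inner ℝ (ν x)) hc
      simpa [inner_add_right, real_inner_smul_right, hν.normal, hν.unit] using this
    have h3 : dAt F x (c 0 • tb x 0 + c 1 • tb x 1) = 0 := by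
      simpa [h2] using hc
    have h4 : c 0 • tb x 0 + c 1 • tb x 1 = 0 := by
      by_contra h
      have := hk.pos x _ h
      rw [← hF, h3] at this
      simp at this
    have h5 := Fintype.linearIndependent_iff.1 (linearIndependent_tb x) ![c 0, c 1]
      (by simpa [Fin.sum_univ_two] using h4)
    intro i
    fin_cases i
    · exact h5 0
    · exact h5 1
    · exact h2
  have hspan := hli.span_eq_top_of_card_eq_finrank (by simp)
  have hle : Submodule.span ℝ (Set.range ![dAt F x (tb x 0), dAt F x (tb x 1), ν x]) ≤
      (innerₗ E3 w).ker := by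
    rw [Submodule.span_le]
    rintro _ ⟨i, rfl⟩
    simp only [SetLike.mem_coe, LinearMap.mem_ker, innerₗ_apply_apply]
    rw [real_inner_comm]
    fin_cases i
    · exact hw _
    · exact hw _
    · exact hw'
  have h6 : w ∈ (innerₗ E3 w).ker := hle (hspan ▸ Submodule.mem_top)
  simpa using h6

theorem IsNormalFrame.eq_timelikeNormal (hg : IsMetric g)
    (hX : MDifferentiable (𝓡 2) 𝓘(ℝ, Minkowski) X)
    (hiso : ∀ (x : S) (v w : TangentSpace (𝓡 2) x), eta (dAt X x v) (dAt X x w) = g x v w)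
    (hν : IsUnitNormal (projection X) ν) {e₄ : S → Minkowski}
    (he : IsNormalFrame X (liftNormal ν) e₄) : e₄ = timelikeNormal g X := by
  ext1 x
  set f := areaFactor g (timeFunction X) x with hf
  have hfp : 0 < f := hg.areaFactor_pos _ x
  have hsq : f ^ 2 = 1 + dAt (timeFunction X) x (grad g (timeFunction X) x) := by
    rw [hg.apply_grad_self]; exact hg.areaFactor_sq _ x
  have ha : 0 < (e₄ x).1 := by
    have := he.future x
    rw [eta_comm, eta_T0_left] at this; linarith
  have hin := inner_dAt_projection hX hiso
  -- the spatial part of `(1 + |∇τ|²) e₄ - a (T₀ + dX(∇τ))`, where `a` is the time component of `e₄`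
  have hw : f ^ 2 • (e₄ x).2 -
      (e₄ x).1 • dAt (projection X) x (grad g (timeFunction X) x) = 0 := by
    refine eq_zero_of_orthogonal (x := x) (hg.graphMetric _) hin hν (fun v => ?_) ?_
    · have h1 := he.normal₄ x v
      rw [dAt_eq_prodMk hX] at h1
      simp only [eta] at h1
      rw [inner_sub_right, real_inner_smul_right, real_inner_smul_right, hin, graphMetric_apply,
        hg.symm, hg.apply_grad, real_inner_comm, hsq]
      linear_combination (1 + dAt (timeFunction X) x (grad g (timeFunction X) x)) * h1
    · have h1 := he.ortho x
      simp only [eta, liftNormal] at h1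
      rw [inner_sub_right, real_inner_smul_right, real_inner_smul_right, hν.normal]
      linear_combination f ^ 2 * h1
  have hN : e₄ x = ((e₄ x).1 * (f ^ 2)⁻¹) • (f • timelikeNormal g X x) := by
    rw [timelikeNormal, ← hf, smul_inv_smul₀ hfp.ne', dAt_eq_prodMk hX]
    refine Prod.ext ?_ ?_
    · simp only [T0, Prod.smul_fst, Prod.fst_add, smul_eq_mul, ← hsq]
      field_simp
    · simp only [T0, Prod.smul_snd, Prod.snd_add, zero_add]
      rw [mul_comm, mul_smul, ← sub_eq_zero.1 hw, inv_smul_smul₀ (by positivity)]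
  have h4 := he.unit₄ x
  have h5 := (isNormalFrame_timelikeNormal hg hX hiso hν).unit₄ x
  rw [hN] at h4 ⊢
  simp only [eta_smul_left, eta_smul_right, h5] at h4
  have h6 : (e₄ x).1 = f := by
    have h7 : (e₄ x).1 ^ 2 = f ^ 2 := by
      field_simp at h4
      linarith
    exact (pow_left_inj₀ ha.le hfp.le two_ne_zero).1 h7
  rw [h6, smul_smul]
  have : f * (f ^ 2)⁻¹ * f = 1 := by field_simp
  rw [this, one_smul]

/-! ### The pointwise identity -/

/-- The bilinear form `⟨dν, dF⟩`. -/
def shapeForm (F ν : S → E3) (x : S) :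
    TangentSpace (𝓡 2) x →ₗ[ℝ] TangentSpace (𝓡 2) x →ₗ[ℝ] ℝ :=
  (innerₗ E3).compl₁₂ (dAt ν x).toLinearMap (dAt F x).toLinearMap

theorem meanCurvature_eq_traceAt (k : ∀ x : S, TangentSpace (𝓡 2) x →L[ℝ]
    TangentSpace (𝓡 2) x →L[ℝ] ℝ) (F : S → E3) (x : S) :
    meanCurvature k F ν x = traceAt k x fun i j => shapeForm F ν x (tb x i) (tb x j) := rfl

theorem eta_traceAt (x : S) (B : Fin 2 → Fin 2 → Minkowski) (u : Minkowski) :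
    eta (traceAt g x B) u = traceAt g x fun i j => eta (B i j) u := by
  rw [traceAt, traceAt, sum_inv_smul_fin_two, sum_inv_smul_fin_two]
  simp only [eta_smul_left, eta_add_left, eta_sub_left, smul_eq_mul]

variable [IsManifold (𝓡 2) ∞ S]

/-- The Weingarten equation `⟨∂ᵢ∂ⱼF, ν⟩ = -⟨∂ᵢν, ∂ⱼF⟩`. -/
theorem inner_fderiv_fderiv_eq_neg {F : S → E3} (hF : ContMDiff (𝓡 2) 𝓘(ℝ, E3) ∞ F)
    (hν : IsUnitNormal F ν) (x : S) (i j : Fin 2) :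
    inner ℝ (fderiv ℝ (fderiv ℝ (F ∘ (chartAt E2 x).symm)) (chartAt E2 x x)
      (EuclideanSpace.single i (1 : ℝ)) (EuclideanSpace.single j (1 : ℝ))) (ν x) =
    -shapeForm F ν x (tb x i) (tb x j) := by
  set φ := chartAt E2 x
  have hx : φ x ∈ φ.target := mem_chart_target E2 x
  have hnh : φ.target ∈ nhds (φ x) := φ.open_target.mem_nhds hx
  have hFd : ContDiffAt ℝ ∞ (F ∘ φ.symm) (φ x) := (contDiffOn_chart_symm_comp hF x).contDiffAt hnh
  have hνd : DifferentiableAt ℝ (ν ∘ φ.symm) (φ x) :=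
    ((contDiffOn_chart_symm_comp hν.smooth x).contDiffAt hnh).differentiableAt (by simp)
  have hF2 : DifferentiableAt ℝ (fderiv ℝ (F ∘ φ.symm)) (φ x) :=
    (hFd.fderiv_right (m := ∞) (by simp)).differentiableAt (by simp)
  -- differentiate `⟨ν, ∂ⱼF⟩ = 0` in the direction `∂ᵢ`
  have hzero : (fun y => inner ℝ ((ν ∘ φ.symm) y)
      (fderiv ℝ (F ∘ φ.symm) y (EuclideanSpace.single j (1 : ℝ)))) =ᶠ[nhds (φ x)]
      fun _ => (0 : ℝ) := by
    filter_upwards [hnh] with y hy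
    rw [← dAt_chartFrame hF x hy]
    exact hν.normal _ _
  have h1 := hzero.fderiv_eq (𝕜 := ℝ)
  have h2 := fderiv_inner_apply ℝ hνd
    (hF2.clm_apply (differentiableAt_const (EuclideanSpace.single j (1 : ℝ))))
    (EuclideanSpace.single i (1 : ℝ))
  rw [h1, fderiv_clm_apply hF2 (differentiableAt_const _)] at h2
  have h3 : shapeForm F ν x (tb x i) (tb x j) = inner ℝ
      (fderiv ℝ (ν ∘ φ.symm) (φ x) (EuclideanSpace.single i (1 : ℝ)))
      (fderiv ℝ (F ∘ φ.symm) (φ x) (EuclideanSpace.single j (1 : ℝ))) := by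
    change inner ℝ (dAt ν x (tb x i)) (dAt F x (tb x j)) = _
    rw [dAt_eq_fderiv_chart (hν.smooth.mdifferentiable (by simp) x),
      dAt_eq_fderiv_chart (hF.mdifferentiable (by simp) x)]
    rfl
  rw [h3, real_inner_comm]
  simp [φ, φ.left_inv] at h2
  linarith

/-- The component along `(0, ν)` of the second fundamental form of `X` is, up to sign, the second
fundamental form of the projection: tangential parts do not contribute, and the time component of
`(0, ν)` vanishes. -/
theorem eta_secondFF (hX : ContMDiff (𝓡 2) 𝓘(ℝ, Minkowski) ∞ X)
    (hν : IsUnitNormal (projection X) ν) (x : S) (i j : Fin 2) :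
    eta (secondFF g X x i j) (liftNormal ν x) =
      -shapeForm (projection X) ν x (tb x i) (tb x j) := by
  have hn : ∀ v, eta (dAt X x v) (liftNormal ν x) = 0 := fun v => by
    rw [dAt_eq_prodMk (hX.mdifferentiable (by simp)), eta_comm]
    simpa [eta, liftNormal] using hν.normal x v
  rw [secondFF, normalPart, eta_sub_left, eta_traceAt]
  simp only [eta_smul_left, hn, mul_zero]
  have h0 : traceAt g x (fun _ _ => (0 : ℝ)) = 0 := by simp [traceAt]
  rw [h0, sub_zero]
  have hF : ContMDiff (𝓡 2) 𝓘(ℝ, E3) ∞ (projection X) :=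
    (ContinuousLinearMap.snd ℝ ℝ E3).contMDiff.comp hX
  rw [← inner_fderiv_fderiv_eq_neg hF hν]
  set φ := chartAt E2 x
  have hx : φ x ∈ φ.target := mem_chart_target E2 x
  have hnh : φ.target ∈ nhds (φ x) := φ.open_target.mem_nhds hx
  have hXd := contDiffOn_chart_symm_comp hX x
  have h1 : fderiv ℝ (projection X ∘ φ.symm) =ᶠ[nhds (φ x)] fun y =>
      (ContinuousLinearMap.snd ℝ ℝ E3).comp (fderiv ℝ (X ∘ φ.symm) y) := by
    filter_upwards [hnh] with y hy
    exact ((ContinuousLinearMap.snd ℝ ℝ E3).hasFDerivAt.comp y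
      ((hXd.contDiffAt (φ.open_target.mem_nhds hy)).differentiableAt (by simp)).hasFDerivAt).fderiv
  have hX2 : DifferentiableAt ℝ (fderiv ℝ (X ∘ φ.symm)) (φ x) :=
    ((hXd.contDiffAt hnh).fderiv_right (m := ∞) (by simp)).differentiableAt
      (by simp)
  rw [h1.fderiv_eq, fderiv_clm_comp (differentiableAt_const _) hX2]
  simp [eta, liftNormal]

/-- The mean curvature of the projection, multiplied by the ratio of the area elements, is the
generalized mean curvature. -/
theorem areaFactor_mul_meanCurvature (hg : IsMetric g)
    (hX : ContMDiff (𝓡 2) 𝓘(ℝ, Minkowski) ∞ X)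
    (hν : IsUnitNormal (projection X) ν) (x : S) :
    areaFactor g (timeFunction X) x *
        meanCurvature (graphMetric g (timeFunction X)) (projection X) ν x =
      generalizedMeanCurvature g X (timeFunction X) (liftNormal ν) (timelikeNormal g X) x := by
  have hf := hg.areaFactor_pos (timeFunction X) x
  have hH : eta (meanCurvatureVector g X x) (liftNormal ν x) =
      -traceAt g x fun i j => shapeForm (projection X) ν x (tb x i) (tb x j) := by
    rw [meanCurvatureVector, eta_traceAt]
    simp only [eta_secondFF hX hν, traceAt, smul_neg, Finset.sum_neg_distrib]
  have hα : connectionForm (liftNormal ν) (timelikeNormal g X) x (grad g (timeFunction X) x) =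
      shapeForm (projection X) ν x (grad g (timeFunction X) x) (grad g (timeFunction X) x)
        / areaFactor g (timeFunction X) x := by
    rw [connectionForm, timelikeNormal, eta_smul_right, dAt_liftNormal
      (hν.smooth.mdifferentiable (by simp)), dAt_eq_prodMk (hX.mdifferentiable (by simp))]
    simp [eta, T0, shapeForm]
    ring
  rw [generalizedMeanCurvature, hH, hα, meanCurvature_eq_traceAt, hg.traceAt_graphMetric]
  change _ = -areaFactor g (timeFunction X) x * _ - _
  field_simp

end Pointwise


section Measure

variable {X : S → Minkowski} {ν : S → E3}

/-! ### Continuity in charts -/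

/-- The components of `g` in each coordinate frame are continuous on the domain of the chart. -/
def ContinuousInCharts (g : ∀ x : S, TangentSpace (𝓡 2) x →L[ℝ] TangentSpace (𝓡 2) x →L[ℝ] ℝ) :
    Prop :=
  ∀ (p : S) (i j : Fin 2), ContinuousOn (fun y => g ((chartAt E2 p).symm y) (chartFrame p y i)
    (chartFrame p y j)) (chartAt E2 p).target

theorem continuous_of_continuousOn_chart {f : S → ℝ}
    (h : ∀ p : S, ContinuousOn (f ∘ (chartAt E2 p).symm) (chartAt E2 p).target) :
    Continuous f := by
  rw [continuous_iff_continuousAt]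
  intro x
  rw [(chartAt E2 x).symm.continuousAt_iff_continuousAt_comp_right (mem_chart_source E2 x)]
  exact (h x).continuousAt ((chartAt E2 x).open_target.mem_nhds (mem_chart_target E2 x))

theorem areaDensity_eq_sqrt (p : S) (y : E2) : areaDensity g p y =
    Real.sqrt (frameGram g ((chartAt E2 p).symm y) (chartFrame p y)).det := rfl

theorem ContinuousInCharts.det_frameGram (hc : ContinuousInCharts g) (p : S) :
    ContinuousOn (fun y => (frameGram g ((chartAt E2 p).symm y) (chartFrame p y)).det)
      (chartAt E2 p).target := by
  simp only [frameGram, Matrix.det_fin_two, Matrix.of_apply]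
  exact ((hc p 0 0).mul (hc p 1 1)).sub ((hc p 0 1).mul (hc p 1 0))

theorem ContinuousInCharts.areaDensity (hc : ContinuousInCharts g) (p : S) :
    ContinuousOn (areaDensity g p) (chartAt E2 p).target :=
  (hc.det_frameGram p).sqrt

theorem areaDensity_graphMetric (hg : IsMetric g) (f : S → ℝ) (p : S) (y : E2) :
    areaDensity (graphMetric g f) p y =
      areaFactor g f ((chartAt E2 p).symm y) * areaDensity g p y := by
  rw [areaDensity_eq_sqrt, areaDensity_eq_sqrt, hg.det_frameGram_graphMetric,
    Real.sqrt_mul (sq_nonneg _), Real.sqrt_sq (hg.areaFactor_pos _ _).le]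

section Smooth

variable [IsManifold (𝓡 2) ∞ S]

/-- A metric induced by a smooth map is continuous in charts. Reading it off from the map spares the
trivializations of the tangent bundle. -/
theorem continuousInCharts_of_isometric (hX : ContMDiff (𝓡 2) 𝓘(ℝ, Minkowski) ∞ X)
    (hiso : ∀ (x : S) (v w : TangentSpace (𝓡 2) x), eta (dAt X x v) (dAt X x w) = g x v w) :
    ContinuousInCharts g := by
  intro p i j
  have h := fun k : Fin 2 => continuousOn_fderiv_chart hX p (EuclideanSpace.single k (1 : ℝ))
  refine ContinuousOn.congr (f := fun y => eta
    (fderiv ℝ (X ∘ (chartAt E2 p).symm) y (EuclideanSpace.single i (1 : ℝ)))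
    (fderiv ℝ (X ∘ (chartAt E2 p).symm) y (EuclideanSpace.single j (1 : ℝ)))) ?_ fun y hy => ?_
  · exact ((h i).fst.mul (h j).fst).neg.add ((h i).snd.inner (h j).snd)
  · simp only [← dAt_chartFrame hX p hy, hiso]

theorem continuousInCharts_of_inner {F : S → E3} (hF : ContMDiff (𝓡 2) 𝓘(ℝ, E3) ∞ F)
    (hiso : ∀ (x : S) (v w : TangentSpace (𝓡 2) x), inner ℝ (dAt F x v) (dAt F x w) = g x v w) :
    ContinuousInCharts g := by
  intro p i j
  have h := fun k : Fin 2 => continuousOn_fderiv_chart hF p (EuclideanSpace.single k (1 : ℝ))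
  refine ((h i).inner (𝕜 := ℝ) (h j)).congr fun y hy => ?_
  simp only [← dAt_chartFrame hF p hy, hiso]

theorem continuous_meanCurvature (hg : IsMetric g) (hc : ContinuousInCharts g) {F : S → E3}
    (hF : ContMDiff (𝓡 2) 𝓘(ℝ, E3) ∞ F) (hν : ContMDiff (𝓡 2) 𝓘(ℝ, E3) ∞ ν) :
    Continuous (meanCurvature g F ν) := by
  refine continuous_of_continuousOn_chart fun p => ?_
  have hb : ∀ i j : Fin 2, ContinuousOn (fun y => shapeForm F ν ((chartAt E2 p).symm y)
      (chartFrame p y i) (chartFrame p y j)) (chartAt E2 p).target := fun i j => by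
    refine ((continuousOn_fderiv_chart hν p (EuclideanSpace.single i (1 : ℝ))).inner (𝕜 := ℝ)
      (continuousOn_fderiv_chart hF p (EuclideanSpace.single j (1 : ℝ)))).congr fun y hy => ?_
    simp only [← dAt_chartFrame hF p hy, ← dAt_chartFrame hν p hy]
    rfl
  refine ContinuousOn.congr (((hc.det_frameGram p).inv₀ fun y hy =>
    (hg.det_frameGram_pos (linearIndependent_chartFrame p hy)).ne').mul
      (((((hc p 1 1).mul (hb 0 0)).sub ((hc p 0 1).mul (hb 0 1))).sub
        ((hc p 1 0).mul (hb 1 0))).add ((hc p 0 0).mul (hb 1 1)))) fun y hy => ?_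
  exact hg.traceAt_eq_frame (linearIndependent_chartFrame p hy) (shapeForm F ν _)

theorem areaDensity_pos (hg : IsMetric g) (p : S) {y : E2} (hy : y ∈ (chartAt E2 p).target) :
    0 < areaDensity g p y :=
  Real.sqrt_pos.2 (hg.det_frameGram_pos (linearIndependent_chartFrame p hy))

theorem continuous_areaFactor (hg : IsMetric g) (hc : ContinuousInCharts g) {f : S → ℝ}
    (hc' : ContinuousInCharts (graphMetric g f)) : Continuous (areaFactor g f) := by
  refine continuous_of_continuousOn_chart fun p => ?_
  refine ((hc'.areaDensity p).div (hc.areaDensity p) fun y hy =>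
    (areaDensity_pos hg p hy).ne').congr fun y hy => ?_
  have := areaDensity_pos hg p hy
  rw [Pi.div_apply, areaDensity_graphMetric hg]
  simp only [Function.comp]
  field_simp

/-! ### The area density as a Gram determinant -/

/-- The Gram matrix of the images of the standard basis under a linear map to Minkowski space. -/
def etaGram (A : E2 →L[ℝ] Minkowski) : Matrix (Fin 2) (Fin 2) ℝ :=
  Matrix.of fun i j => eta (A (EuclideanSpace.single i (1 : ℝ)))
    (A (EuclideanSpace.single j (1 : ℝ)))

/-- Precomposition with an endomorphism of `ℝ²` multiplies the Gram determinant by the square of its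
determinant. -/
theorem det_etaGram_comp (A : E2 →L[ℝ] Minkowski) (B : E2 →L[ℝ] E2) :
    (etaGram (A.comp B)).det = B.det ^ 2 * (etaGram A).det := by
  have hB : ∀ j : Fin 2, B (EuclideanSpace.single j (1 : ℝ)) =
      (B (EuclideanSpace.single j (1 : ℝ)) 0) • (EuclideanSpace.single 0 (1 : ℝ) : E2)
      + (B (EuclideanSpace.single j (1 : ℝ)) 1) • (EuclideanSpace.single 1 (1 : ℝ) : E2) :=
    fun j => by ext i; fin_cases i <;> simp
  have hd : B.det = B (EuclideanSpace.single 0 (1 : ℝ)) 0 * B (EuclideanSpace.single 1 (1 : ℝ)) 1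
      - B (EuclideanSpace.single 1 (1 : ℝ)) 0 * B (EuclideanSpace.single 0 (1 : ℝ)) 1 := by
    rw [ContinuousLinearMap.det, ← LinearMap.det_toMatrix
      (EuclideanSpace.basisFun (Fin 2) ℝ).toBasis, Matrix.det_fin_two]
    simp [LinearMap.toMatrix_apply]
  rw [hd]
  simp only [etaGram, Matrix.det_fin_two, Matrix.of_apply, ContinuousLinearMap.comp_apply]
  have hAB : ∀ j : Fin 2, A (B (EuclideanSpace.single j (1 : ℝ))) =
      (B (EuclideanSpace.single j (1 : ℝ)) 0) • A (EuclideanSpace.single 0 (1 : ℝ))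
      + (B (EuclideanSpace.single j (1 : ℝ)) 1) • A (EuclideanSpace.single 1 (1 : ℝ)) :=
    fun j => by conv_lhs => rw [hB j, map_add, map_smul, map_smul]
  rw [hAB 0, hAB 1]
  simp only [eta_add_left, eta_add_right, eta_smul_left, eta_smul_right]
  ring

theorem areaDensity_eq_sqrt_etaGram (hX : ContMDiff (𝓡 2) 𝓘(ℝ, Minkowski) ∞ X)
    (hiso : ∀ (x : S) (v w : TangentSpace (𝓡 2) x), eta (dAt X x v) (dAt X x w) = g x v w)
    (p : S) {y : E2} (hy : y ∈ (chartAt E2 p).target) :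
    areaDensity g p y = Real.sqrt (etaGram (fderiv ℝ (X ∘ (chartAt E2 p).symm) y)).det := by
  rw [areaDensity_eq_sqrt]
  congr 2
  ext i j
  simp only [frameGram, etaGram, Matrix.of_apply, ← dAt_chartFrame hX p hy, hiso]

end Smooth

/-! ### Area measures -/

theorem withDensity_mono_left {α : Type*} [MeasurableSpace α] {μ ν : Measure α} (h : μ ≤ ν)
    (f : α → ENNReal) : μ.withDensity f ≤ ν.withDensity f := by
  refine Measure.le_iff.2 fun s hs => ?_
  rw [withDensity_apply _ hs, withDensity_apply _ hs]
  exact lintegral_mono' (Measure.restrict_mono le_rfl h) le_rfl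

/-- Multiplication by a positive finite density is an automorphism of the lattice of measures, and
so preserves arbitrary suprema. -/
theorem iSup_withDensity {α ι : Type*} [MeasurableSpace α] (μ : ι → Measure α) {f : α → ENNReal}
    (hf : Measurable f) (h0 : ∀ x, f x ≠ 0) (ht : ∀ x, f x ≠ ⊤) :
    ⨆ i, (μ i).withDensity f = (⨆ i, μ i).withDensity f := by
  refine le_antisymm (iSup_le fun i => withDensity_mono_left (le_iSup μ i) f) ?_
  have h1 : ⨆ i, μ i ≤ (⨆ i, (μ i).withDensity f).withDensity fun x => (f x)⁻¹ :=
    iSup_le fun i => by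
      rw [← withDensity_inv_same (μ := μ i) hf (.of_forall h0) (.of_forall ht)]
      exact withDensity_mono_left (le_iSup (fun i => (μ i).withDensity f) i) _
  refine (withDensity_mono_left h1 f).trans_eq ?_
  have h2 := withDensity_inv_same (μ := ⨆ i, (μ i).withDensity f) (f := fun x => (f x)⁻¹) hf.inv
    (.of_forall fun x => by simpa using ht x) (.of_forall fun x => by simpa using h0 x)
  simp only [inv_inv] at h2
  exact h2

variable [MeasurableSpace S] [BorelSpace S]

theorem measurableSet_chart_target_inter (p : S) {A : Set S} (hA : MeasurableSet A) :
    MeasurableSet ((chartAt E2 p).target ∩ (chartAt E2 p).symm ⁻¹' A) := by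
  have h : Measurable fun y : (chartAt E2 p).target => (chartAt E2 p).symm y :=
    ((chartAt E2 p).continuousOn_symm.comp_continuous continuous_subtype_val
      fun y => y.2).measurable
  have h2 := (chartAt E2 p).open_target.measurableSet.subtype_image (h hA)
  convert h2 using 1
  ext y
  simp [and_comm]

theorem aemeasurable_chart_symm (p : S) {μ : Measure E2}
    (hμ : μ ≪ volume.restrict (chartAt E2 p).target) : AEMeasurable (chartAt E2 p).symm μ :=
  ((chartAt E2 p).continuousOn_symm.aemeasurable
    (chartAt E2 p).open_target.measurableSet).mono_ac hμ

theorem chartAreaMeasure_apply (p : S) {A : Set S} (hA : MeasurableSet A) :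
    chartAreaMeasure g p A = ∫⁻ y in (chartAt E2 p).target ∩ (chartAt E2 p).symm ⁻¹' A,
      ENNReal.ofReal (areaDensity g p y) := by
  rw [chartAreaMeasure, Measure.map_apply_of_aemeasurable
    (aemeasurable_chart_symm p (withDensity_absolutelyContinuous _ _)) hA, withDensity_apply',
    Measure.restrict_restrict' (chartAt E2 p).open_target.measurableSet, Set.inter_comm]

theorem chartAreaMeasure_inter_source (p : S) {A : Set S} (hA : MeasurableSet A) :
    chartAreaMeasure g p (A ∩ (chartAt E2 p).source) = chartAreaMeasure g p A := by
  rw [chartAreaMeasure_apply p hA, chartAreaMeasure_apply p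
    (hA.inter (chartAt E2 p).open_source.measurableSet)]
  congr 2
  ext y
  simp only [Set.mem_inter_iff, Set.mem_preimage]
  exact ⟨fun h => ⟨h.1, h.2.1⟩, fun h => ⟨h.1, h.2, (chartAt E2 p).map_target h.1⟩⟩

/-- If the area density of `k` is `f` times that of `g`, then the same holds for the area measures in
the chart. -/
theorem chartAreaMeasure_eq_withDensity
    {k : ∀ x : S, TangentSpace (𝓡 2) x →L[ℝ] TangentSpace (𝓡 2) x →L[ℝ] ℝ} {p : S} {f : S → ℝ}
    (hf : Measurable f) (hf0 : ∀ x, 0 ≤ f x)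
    (hc : ContinuousOn (areaDensity g p) (chartAt E2 p).target)
    (h : ∀ y, areaDensity k p y = f ((chartAt E2 p).symm y) * areaDensity g p y) :
    chartAreaMeasure k p =
      (chartAreaMeasure g p).withDensity fun x => ENNReal.ofReal (f x) := by
  have ht := (chartAt E2 p).open_target.measurableSet
  have hm : Measurable fun x => ENNReal.ofReal (f x) := hf.ennreal_ofReal
  ext A hA
  have hA' := measurableSet_chart_target_inter p hA
  rw [withDensity_apply _ hA, chartAreaMeasure_apply p hA, ← lintegral_indicator hA]
  rw [chartAreaMeasure, lintegral_map' (hm.indicator hA).aemeasurable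
    (aemeasurable_chart_symm p (withDensity_absolutelyContinuous _ _))]
  have hρ : AEMeasurable (fun y => ENNReal.ofReal (areaDensity g p y))
    (volume.restrict (chartAt E2 p).target) := (hc.aemeasurable ht).ennreal_ofReal
  change _ = ∫⁻ y, ((A.indicator fun x => ENNReal.ofReal (f x)) ∘ (chartAt E2 p).symm) y ∂_
  rw [lintegral_withDensity_eq_lintegral_mul₀ hρ
    ((hm.indicator hA).comp_aemeasurable (aemeasurable_chart_symm p .rfl)),
    ← lintegral_indicator hA', ← lintegral_indicator ht]
  congr 1
  ext y
  by_cases h1 : y ∈ (chartAt E2 p).target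
  · by_cases h2 : (chartAt E2 p).symm y ∈ A
    · simp [h1, h2, h, mul_comm, ENNReal.ofReal_mul' (hf0 _)]
    · simp [h1, h2]
  · simp [h1]

theorem areaMeasure_graphMetric [IsManifold (𝓡 2) ∞ S] (hg : IsMetric g)
    (hc : ContinuousInCharts g) {f : S → ℝ} (hc' : ContinuousInCharts (graphMetric g f)) :
    areaMeasure (graphMetric g f) =
      (areaMeasure g).withDensity fun x => ENNReal.ofReal (areaFactor g f x) := by
  have hm := (continuous_areaFactor hg hc hc').measurable
  have hp := hg.areaFactor_pos f
  rw [areaMeasure, areaMeasure, ← iSup_withDensity _ hm.ennreal_ofReal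
    (fun x => by simpa using hp x) (fun x => ENNReal.ofReal_ne_top)]
  congr 1
  ext1 p
  exact chartAreaMeasure_eq_withDensity hm (fun x => (hp x).le) (hc.areaDensity p)
    (areaDensity_graphMetric hg f p)

/-! ### Independence of the chart and finiteness of the area -/

section Finite

variable [IsManifold (𝓡 2) ∞ S]

/-- The area measures of two charts agree on the intersection of the chart domains. -/
theorem chartAreaMeasure_eq_of_subset (hX : ContMDiff (𝓡 2) 𝓘(ℝ, Minkowski) ∞ X)
    (hiso : ∀ (x : S) (v w : TangentSpace (𝓡 2) x), eta (dAt X x v) (dAt X x w) = g x v w)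
    {p q : S} {A : Set S} (hA : MeasurableSet A) (hp : A ⊆ (chartAt E2 p).source)
    (hq : A ⊆ (chartAt E2 q).source) : chartAreaMeasure g p A = chartAreaMeasure g q A := by
  set φ := chartAt E2 p with hφ
  set ψ := chartAt E2 q with hψ
  have hT : ∀ y ∈ φ.target ∩ φ.symm ⁻¹' A, DifferentiableAt ℝ (ψ ∘ φ.symm) y := fun y hy => by
    have h1 : ContMDiffAt 𝓘(ℝ, E2) (𝓡 2) ∞ φ.symm y :=
      (contMDiffOn_chart_symm (I := 𝓡 2) (x := p)).contMDiffAt (φ.open_target.mem_nhds hy.1)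
    have h2 : ContMDiffAt (𝓡 2) 𝓘(ℝ, E2) ∞ ψ (φ.symm y) :=
      (contMDiffOn_chart (I := 𝓡 2) (x := q)).contMDiffAt (ψ.open_source.mem_nhds (hq hy.2))
    exact (contMDiffAt_iff_contDiffAt.1 (h2.comp y h1)).differentiableAt (by simp)
  have himage : ψ ∘ φ.symm '' (φ.target ∩ φ.symm ⁻¹' A) = ψ.target ∩ ψ.symm ⁻¹' A := by
    ext z
    constructor
    · rintro ⟨y, ⟨hy1, hy2⟩, rfl⟩
      refine ⟨ψ.map_source (hq hy2), ?_⟩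
      simpa [ψ.left_inv (hq hy2)] using hy2
    · rintro ⟨hz1, hz2⟩
      refine ⟨φ (ψ.symm z), ⟨φ.map_source (hp hz2), ?_⟩, ?_⟩
      · simpa [φ.left_inv (hp hz2)] using hz2
      · simp [φ.left_inv (hp hz2), ψ.right_inv hz1]
  have hinj : Set.InjOn (ψ ∘ φ.symm) (φ.target ∩ φ.symm ⁻¹' A) :=
    ψ.injOn.comp (φ.symm.injOn.mono Set.inter_subset_left) fun y hy => hq hy.2
  have hmeas := measurableSet_chart_target_inter p hA
  rw [chartAreaMeasure_apply p hA, chartAreaMeasure_apply q hA, ← hφ, ← hψ, ← himage,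
    lintegral_image_eq_lintegral_abs_det_fderiv_mul volume hmeas
      (fun y hy => (hT y hy).hasFDerivAt.hasFDerivWithinAt) hinj]
  refine setLIntegral_congr_fun hmeas fun y hy => ?_
  have hψy : (ψ ∘ φ.symm) y ∈ ψ.target := ψ.map_source (hq hy.2)
  -- near `y` the parametrization by `φ` is the one by `ψ` after the transition map
  have hev : X ∘ φ.symm =ᶠ[nhds y] (X ∘ ψ.symm) ∘ (ψ ∘ φ.symm) := by
    have h1 : ∀ᶠ z in nhds y, φ.symm z ∈ ψ.source :=
      (φ.symm.continuousAt hy.1).eventually (ψ.open_source.mem_nhds (hq hy.2))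
    filter_upwards [h1] with z hz
    simp [ψ.left_inv hz]
  have hXψ : DifferentiableAt ℝ (X ∘ ψ.symm) ((ψ ∘ φ.symm) y) :=
    ((contDiffOn_chart_symm_comp hX q).contDiffAt
      (ψ.open_target.mem_nhds hψy)).differentiableAt (by simp)
  change ENNReal.ofReal (areaDensity g p y) = _
  rw [areaDensity_eq_sqrt_etaGram hX hiso p hy.1, areaDensity_eq_sqrt_etaGram hX hiso q hψy,
    ← hφ, ← hψ, hev.fderiv_eq, fderiv_comp y hXψ (hT y hy), det_etaGram_comp,
    Real.sqrt_mul (sq_nonneg _), Real.sqrt_sq_eq_abs, ENNReal.ofReal_mul (abs_nonneg _)]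

/-- The area of a compact surface is finite. -/
theorem isFiniteMeasure_areaMeasure [CompactSpace S] [T2Space S]
    (hX : ContMDiff (𝓡 2) 𝓘(ℝ, Minkowski) ∞ X)
    (hiso : ∀ (x : S) (v w : TangentSpace (𝓡 2) x), eta (dAt X x v) (dAt X x w) = g x v w) :
    IsFiniteMeasure (areaMeasure g) := by
  have hc := continuousInCharts_of_isometric hX hiso
  have hK : ∀ x : S, ∃ K ∈ nhds x, IsCompact K ∧ K ⊆ (chartAt E2 x).source := fun x => by
    have := ChartedSpace.locallyCompactSpace E2 S
    obtain ⟨K, hK, hs, hcK⟩ := LocallyCompactSpace.local_compact_nhds x _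
      ((chartAt E2 x).open_source.mem_nhds (mem_chart_source E2 x))
    exact ⟨K, hK, hcK, hs⟩
  choose K hKn hKc hKs using hK
  have hKm : ∀ x, MeasurableSet (K x) := fun x => (hKc x).measurableSet
  obtain ⟨t, -, ht⟩ := isCompact_univ.elim_nhds_subcover K fun x _ => hKn x
  have hfin : ∀ x, chartAreaMeasure g x (K x) < ⊤ := fun x => by
    rw [chartAreaMeasure_apply x (hKm x)]
    have h1 : (chartAt E2 x).target ∩ (chartAt E2 x).symm ⁻¹' K x = chartAt E2 x '' K x := by
      rw [(chartAt E2 x).image_eq_target_inter_inv_preimage (hKs x)]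
    rw [h1]
    have h2 : IsCompact (chartAt E2 x '' K x) :=
      (hKc x).image_of_continuousOn ((chartAt E2 x).continuousOn.mono (hKs x))
    have h3 := ((hc.areaDensity x).mono (by
      rintro _ ⟨z, hz, rfl⟩; exact (chartAt E2 x).map_source (hKs x hz))).integrableOn_compact
      (μ := volume) h2
    exact h3.lintegral_lt_top
  have hle : areaMeasure g ≤ ∑ x ∈ t, (chartAreaMeasure g x).restrict (K x) := by
    refine iSup_le fun p => Measure.le_iff.2 fun A hA => ?_
    have hcov : A ⊆ ⋃ x ∈ t, A ∩ K x := fun z hz => by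
      obtain ⟨x, hx, hzx⟩ := Set.mem_iUnion₂.1 (ht (Set.mem_univ z))
      exact Set.mem_iUnion₂.2 ⟨x, hx, hz, hzx⟩
    calc chartAreaMeasure g p A ≤ ∑ x ∈ t, chartAreaMeasure g p (A ∩ K x) :=
          (measure_mono hcov).trans (measure_biUnion_finset_le t _)
      _ ≤ ∑ x ∈ t, (chartAreaMeasure g x).restrict (K x) A := by
          refine Finset.sum_le_sum fun x _ => ?_
          have hAK := hA.inter (hKm x)
          rw [Measure.restrict_apply hA, ← chartAreaMeasure_inter_source p hAK,
            chartAreaMeasure_eq_of_subset hX hiso (q := x)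
              (hAK.inter (chartAt E2 p).open_source.measurableSet) Set.inter_subset_right
              fun z hz => hKs x hz.1.2]
          exact measure_mono Set.inter_subset_left
      _ = _ := by rw [Measure.finsetSum_apply]
  refine ⟨(hle _).trans_lt ?_⟩
  rw [Measure.finsetSum_apply]
  refine ENNReal.sum_lt_top.2 fun x _ => ?_
  rw [Measure.restrict_apply_univ]
  exact hfin x

end Finite

end Measure

end WangYau

end

theorem proposition4p2 {S : Type*} [TopologicalSpace S] [ChartedSpace E2 S]
    [IsManifold (𝓡 2) ∞ S] [CompactSpace S] [T2Space S] [MeasurableSpace S] [BorelSpace S]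
    (σ : Bundle.ContMDiffRiemannianMetric (𝓡 2) ∞ E2 (fun x : S => TangentSpace (𝓡 2) x))
    (X : S → Minkowski) (hX : ContMDiff (𝓡 2) 𝓘(ℝ, Minkowski) ∞ X)
    (hiso : ∀ (x : S) (v w : TangentSpace (𝓡 2) x), eta (dAt X x v) (dAt X x w) = σ.inner x v w)
    (ν : S → E3) (hν : IsUnitNormal (projection X) ν) :
    -- the projected surface has the induced metric `σ + dτ ⊗ dτ`
    (∀ (x : S) (v w : TangentSpace (𝓡 2) x),
      inner ℝ (dAt (projection X) x v) (dAt (projection X) x w) =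
        graphMetric σ.inner (timeFunction X) x v w) ∧
    -- `ν`, translated along `T₀`, determines the frame of the normal bundle
    (∃! e₄ : S → Minkowski, IsNormalFrame X (liftNormal ν) e₄) ∧
    ∀ e₄ : S → Minkowski, IsNormalFrame X (liftNormal ν) e₄ →
      Integrable (meanCurvature (graphMetric σ.inner (timeFunction X)) (projection X) ν)
        (areaMeasure (graphMetric σ.inner (timeFunction X))) ∧
      Integrable (generalizedMeanCurvature σ.inner X (timeFunction X) (liftNormal ν) e₄)
        (areaMeasure σ.inner) ∧
      ∫ x, meanCurvature (graphMetric σ.inner (timeFunction X)) (projection X) ν x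
          ∂(areaMeasure (graphMetric σ.inner (timeFunction X))) =
        ∫ x, generalizedMeanCurvature σ.inner X (timeFunction X) (liftNormal ν) e₄ x
          ∂(areaMeasure σ.inner) := by
  have hg : IsMetric σ.inner := ⟨σ.symm, σ.pos⟩
  have hXd : MDifferentiable (𝓡 2) 𝓘(ℝ, Minkowski) X := hX.mdifferentiable (by simp)
  have hF : ContMDiff (𝓡 2) 𝓘(ℝ, E3) ∞ (projection X) :=
    (ContinuousLinearMap.snd ℝ ℝ E3).contMDiff.comp hX
  have hproj := inner_dAt_projection hXd hiso
  refine ⟨hproj, ⟨timelikeNormal σ.inner X, isNormalFrame_timelikeNormal hg hXd hiso hν,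
    fun e₄ he => he.eq_timelikeNormal hg hXd hiso hν⟩, fun e₄ he => ?_⟩
  obtain rfl := he.eq_timelikeNormal hg hXd hiso hν
  have hc := continuousInCharts_of_isometric hX hiso
  have hc' := continuousInCharts_of_inner hF hproj
  have hf := continuous_areaFactor hg hc hc'
  have hp := hg.areaFactor_pos (timeFunction X)
  have hk := continuous_meanCurvature (hg.graphMetric _) hc' hF hν.smooth
  have hpt : (fun x => areaFactor σ.inner (timeFunction X) x *
        meanCurvature (graphMetric σ.inner (timeFunction X)) (projection X) ν x) =
      generalizedMeanCurvature σ.inner X (timeFunction X) (liftNormal ν)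
        (timelikeNormal σ.inner X) := funext (areaFactor_mul_meanCurvature hg hX hν)
  have hfin := isFiniteMeasure_areaMeasure hX hiso
  have hint : Integrable (generalizedMeanCurvature σ.inner X (timeFunction X) (liftNormal ν)
      (timelikeNormal σ.inner X)) (areaMeasure σ.inner) := by
    rw [← hpt]
    exact integrableOn_univ.1 ((hf.mul hk).continuousOn.integrableOn_compact isCompact_univ)
  have hdens : ∀ x, (ENNReal.ofReal (areaFactor σ.inner (timeFunction X) x)).toReal •
        meanCurvature (graphMetric σ.inner (timeFunction X)) (projection X) ν x =
      generalizedMeanCurvature σ.inner X (timeFunction X) (liftNormal ν)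
        (timelikeNormal σ.inner X) x := fun x => by
    rw [ENNReal.toReal_ofReal (hp x).le, smul_eq_mul, ← hpt]
  rw [areaMeasure_graphMetric hg hc hc']
  refine ⟨?_, hint, ?_⟩
  · rw [integrable_withDensity_iff_integrable_smul' hf.measurable.ennreal_ofReal
      (.of_forall fun x => ENNReal.ofReal_lt_top)]
    simpa only [hdens] using hint
  · rw [integral_withDensity_eq_integral_toReal_smul hf.measurable.ennreal_ofReal
      (.of_forall fun x => ENNReal.ofReal_lt_top)]
    simp only [hdens]
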